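/- Let $G$ be a finite simple graph that is a block graph, i.e. every block of $G$ (a maximal subgraph that is connected and remains connected upon the removal of any single vertex, where the empty graph counts as connected) is a complete graph. Suppose that $\operatorname{diam}(G)\le 4$, where $\operatorname{diam}(G)$ is the maximum distance between two vertices lying in the same connected component of $G$ (so $G$ need not be connected). For $r\ge 1$ let $\mathrm{Ind}_r(G)$ be the simplicial complex whose faces are the sets $A\subseteq V(G)$ such that every connected component of the induced subgraph $G[A]$ has at most $r$ vertices. Then for every $r\ge 2$ the complex $\mathrm{Ind}_r(G)$ is shellable (in the nonpure sense), i.e. its facets can be ordered $F_1,\dots,F_t$, without repetition, so that for each $k>1$ the simplicial complex $\langle F_k\rangle\cap\langle F_1,\dots,F_{k-1}\rangle$ is pure of dimension $\dim F_k-1$, where $\langle\mathcal F\rangle$ denotes the simplicial complex generated by $\mathcal F$. -/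

import Mathlib

/-! ### Simplicial complexes and (nonpure) shellability

A simplicial complex on `V` is a family of finite subsets of `V` closed under taking subsets,
i.e. a `LowerSet (Finset V)`; the empty set is a face of every nonvoid complex.
The complex generated by a family is its `lowerClosure` (`LowerSet.Iic F` for a single set `F`),
and the intersection of two complexes is `⊓`. -/

/-- A facet of a simplicial complex is a face that is maximal under inclusion. -/
def IsFacet {V : Type*} (Δ : LowerSet (Finset V)) (F : Finset V) : Prop :=
  Maximal (fun A => A ∈ Δ) F

/-- The dimension of a face is its number of vertices minus one, so `dim ∅ = -1`. -/
def faceDim {V : Type*} (F : Finset V) : ℤ := (F.card : ℤ) - 1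

/-- A complex is pure of dimension `d` if it is nonvoid and all its facets have dimension `d`. -/
def IsPureOfDim {V : Type*} (Δ : LowerSet (Finset V)) (d : ℤ) : Prop :=
  (Δ : Set (Finset V)).Nonempty ∧ ∀ F, IsFacet Δ F → faceDim F = d

/-- A (not necessarily pure) complex is shellable if its facets can be listed without repetition
as `F 0, …, F (t - 1)` such that, for every `k` other than the first index, the complex
`⟨F k⟩ ∩ ⟨F 0, …, F (k - 1)⟩` is pure of dimension `dim (F k) - 1`. -/
def IsShellable {V : Type*} (Δ : LowerSet (Finset V)) : Prop :=
  ∃ (t : ℕ) (F : Fin t → Finset V),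
    Function.Injective F ∧ (∀ A, IsFacet Δ A ↔ A ∈ Set.range F) ∧
      ∀ k : Fin t, 0 < (k : ℕ) →
        IsPureOfDim (LowerSet.Iic (F k) ⊓ lowerClosure (F '' Set.Iio k)) (faceDim (F k) - 1)

namespace SimpleGraph

/-! ### The `r`-independence complex -/

/-- A set `A` of vertices is `r`-independent if every connected component of the induced
subgraph `G[A]` has at most `r` vertices. -/
def IsRIndep {V : Type*} (G : SimpleGraph V) (r : ℕ) (A : Finset V) : Prop :=
  ∀ c : (G.induce (A : Set V)).ConnectedComponent, c.supp.encard ≤ r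

theorem IsRIndep.mono {V : Type*} {G : SimpleGraph V} {r : ℕ} {A B : Finset V}
    (hB : G.IsRIndep r B) (hAB : A ⊆ B) : G.IsRIndep r A := by
  intro c
  let f := G.induceHomOfLE (show (A : Set V) ≤ (B : Set V) from Finset.coe_subset.2 hAB)
  refine le_trans (Set.encard_le_encard_of_injOn (t := (c.map f.toHom).supp) (f := f) ?_
    f.injective.injOn) (hB _)
  intro x hx
  rw [ConnectedComponent.mem_supp_iff] at hx ⊢
  rw [← hx]
  rfl

/-- The `r`-independence complex of `G`: its faces are the `r`-independent sets of vertices. -/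
def rIndComplex {V : Type*} (G : SimpleGraph V) (r : ℕ) : LowerSet (Finset V) where
  carrier := {A | G.IsRIndep r A}
  lower' := fun _ _ hAB hB => IsRIndep.mono hB hAB

/-! ### Block graphs -/

/-- A block of `G` is a maximal subgraph among those that are connected and remain connected upon
the removal of any single vertex. Removing the only vertex of a one-vertex graph leaves
the empty graph, which counts as connected here; so an isolated vertex is a block, and so is a
bridge together with its two ends. -/
def IsBlock {V : Type*} (G : SimpleGraph V) (B : G.Subgraph) : Prop :=
  Maximal (fun H : G.Subgraph => H.Connected ∧ ∀ v, (H.deleteVerts {v}).Preconnected) B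

/-- A block graph is a graph all of whose blocks are complete graphs. -/
def IsBlockGraph {V : Type*} (G : SimpleGraph V) : Prop :=
  ∀ B : G.Subgraph, G.IsBlock B → ∀ u ∈ B.verts, ∀ v ∈ B.verts, u ≠ v → B.Adj u v

end SimpleGraph

/-! ### Shellings built from simplicial vertices of links -/

section Shelling

variable {V : Type*}

/-! The facets containing a face `W` are shelled by induction on the number of vertices outside `W`.
If `W` is not a facet and `v` is simplicial in its link, the facets through `W ∪ {v}` come first.
Any other facet `F ⊇ W` has a least subset `T ⊇ W` to which `v` cannot be added, and the facets with
a given `T` are exactly those containing `T`; each group is shelled by induction. A facet `E` of the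
first list or of another group misses some `x ∈ T`, and `v` can replace `x` in `F`, so `F \ {x}`
lies in a facet of the first list (`exists_isShellingFrom_of_isSimplicialVertex`).

Simplicial vertices come from the geometry of the graph. A component of a block graph with diameter
at most 4 has a vertex `c` within distance 2 of all others (`IsBlockGraph.exists_center`). Among the
vertices of this component that can be added to `W`, one at distance 2 from `c` is simplicial
because its neighbours form a clique. Failing that, a neighbour of `c` with the fewest vertices of
`W` beyond it is simplicial, by the count in `isRIndep_insert_erase`. If only `c` can be added, `c`
itself works (`IsBlockGraph.exists_isSimplicialVertex`). -/

/-- `IsShellingFrom P L` says that each entry `F` of the list `L` meets every member of `P` and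
every earlier entry of `L` inside a codimension one face of `F` which is again contained in
a member of `P` or in an earlier entry. -/
def IsShellingFrom [DecidableEq V] (P : Set (Finset V)) : List (Finset V) → Prop
  | [] => True
  | F :: L => (∀ E ∈ P, ∃ E' ∈ P, ∃ x ∈ F, x ∉ E ∧ F.erase x ⊆ E') ∧
      IsShellingFrom (insert F P) L

namespace IsShellingFrom

variable [DecidableEq V]

theorem append {P : Set (Finset V)} {L₁ L₂ : List (Finset V)} (h₁ : IsShellingFrom P L₁)
    (h₂ : IsShellingFrom (P ∪ {F | F ∈ L₁}) L₂) : IsShellingFrom P (L₁ ++ L₂) := by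
  induction L₁ generalizing P with
  | nil => simpa using h₂
  | cons F L ih =>
    refine ⟨h₁.1, ih h₁.2 ?_⟩
    convert h₂ using 1
    ext E
    simp only [Set.mem_union, Set.mem_insert_iff, Set.mem_ofPred_eq, List.mem_cons]
    tauto

theorem union_left {P Q : Set (Finset V)} {L : List (Finset V)} (h : IsShellingFrom Q L)
    (hP : ∀ F ∈ L, ∀ E ∈ P, ∃ E' ∈ P, ∃ x ∈ F, x ∉ E ∧ F.erase x ⊆ E') :
    IsShellingFrom (P ∪ Q) L := by
  induction L generalizing Q with
  | nil => trivial
  | cons F L ih =>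
    refine ⟨?_, ?_⟩
    · rintro E (hE | hE)
      · obtain ⟨E', hE', h'⟩ := hP F (by simp) E hE
        exact ⟨E', Or.inl hE', h'⟩
      · obtain ⟨E', hE', h'⟩ := h.1 E hE
        exact ⟨E', Or.inr hE', h'⟩
    · rw [← Set.union_insert]
      exact ih h.2 fun F' hF' => hP F' (List.mem_cons_of_mem _ hF')

/-- Comparisons between different groups find their witness `E'` in `P`, so the order of the groups
does not matter. -/
theorem flatMap {ι : Type*} {P : Set (Finset V)} {l : List ι} {L : ι → List (Finset V)}
    (hl : l.Nodup) (h : ∀ i ∈ l, IsShellingFrom ∅ (L i))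
    (hP : ∀ i ∈ l, ∀ F ∈ L i, ∀ E, (E ∈ P ∨ ∃ j ∈ l, j ≠ i ∧ E ∈ L j) →
      ∃ E' ∈ P, ∃ x ∈ F, x ∉ E ∧ F.erase x ⊆ E') : IsShellingFrom P (l.flatMap L) := by
  induction l generalizing P with
  | nil => trivial
  | cons i l ih =>
    rw [List.flatMap_cons]
    rw [List.nodup_cons] at hl
    refine append ?_ (ih hl.2 (fun j hj => h j (List.mem_cons_of_mem _ hj)) ?_)
    · have := union_left (P := P) (h i (by simp))
        fun F hF E hE => hP i (by simp) F hF E (Or.inl hE)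
      rwa [Set.union_empty] at this
    · intro j hj F hF E hE
      obtain ⟨E', hE', h'⟩ := hP j (List.mem_cons_of_mem _ hj) F hF E <| by
        rcases hE with (hE | hE) | ⟨k, hk, hkj, hE⟩
        · exact Or.inl hE
        · exact Or.inr ⟨i, by simp, fun hij => hl.1 (hij ▸ hj), hE⟩
        · exact Or.inr ⟨k, List.mem_cons_of_mem _ hk, hkj, hE⟩
      exact ⟨E', Or.inl hE', h'⟩

theorem exists_of_lt {P : Set (Finset V)} {L : List (Finset V)} (h : IsShellingFrom P L)
    {k : ℕ} (hk : k < L.length) {E : Finset V}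
    (hE : E ∈ P ∨ ∃ j, ∃ hj : j < k, L[j] = E) :
    ∃ E', (E' ∈ P ∨ ∃ j, ∃ hj : j < k, L[j] = E') ∧
      ∃ x ∈ L[k], x ∉ E ∧ L[k].erase x ⊆ E' := by
  induction L generalizing P k with
  | nil => simp at hk
  | cons F L ih =>
    cases k with
    | zero =>
      obtain ⟨E', hE', h'⟩ := h.1 E (by simpa using hE)
      exact ⟨E', Or.inl hE', h'⟩
    | succ k =>
      have key : ∀ E, (E ∈ P ∨ ∃ j, ∃ hj : j < k + 1, (F :: L)[j] = E) ↔
          (E ∈ insert F P ∨ ∃ j, ∃ hj : j < k,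
            L[j]'(hj.trans (Nat.lt_of_succ_lt_succ hk)) = E) := by
        intro E
        constructor
        · rintro (hE | ⟨_ | j, hj, rfl⟩)
          · exact Or.inl (Or.inr hE)
          · exact Or.inl (Or.inl rfl)
          · exact Or.inr ⟨j, Nat.lt_of_succ_lt_succ hj, rfl⟩
        · rintro ((rfl | hE) | ⟨j, hj, rfl⟩)
          · exact Or.inr ⟨0, k.succ_pos, rfl⟩
          · exact Or.inl hE
          · exact Or.inr ⟨j + 1, Nat.succ_lt_succ hj, rfl⟩
      obtain ⟨E', hE', h'⟩ := ih h.2 (Nat.lt_of_succ_lt_succ hk) ((key E).1 hE)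
      exact ⟨E', (key E').2 hE', h'⟩

end IsShellingFrom

theorem isShellable_of_isShellingFrom [DecidableEq V] {Δ : LowerSet (Finset V)}
    {L : List (Finset V)} (hL : L.Nodup) (hmem : ∀ F, F ∈ L ↔ IsFacet Δ F)
    (h : IsShellingFrom ∅ L) : IsShellable Δ := by
  refine ⟨L.length, L.get, List.nodup_iff_injective_get.1 hL, ?_, ?_⟩
  · intro A
    rw [Set.range_list_get]
    exact (hmem A).symm
  · intro k hk
    refine ⟨⟨∅, ?_⟩, ?_⟩
    · refine ⟨by simp, ?_⟩
      exact ⟨L.get ⟨0, hk.trans k.2⟩, ⟨⟨0, hk.trans k.2⟩, hk, rfl⟩, by simp⟩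
    · rintro A ⟨⟨hA, E, ⟨j, hj, rfl⟩, hAE⟩, hmax⟩
      have hA : A ⊆ L.get k := hA
      have hAE : A ⊆ L.get j := hAE
      obtain ⟨E', hE', x, hx, hxE, hsub⟩ := h.exists_of_lt k.2 (E := L.get j)
        (Or.inr ⟨j, hj, rfl⟩)
      rcases hE' with hE' | ⟨i, hi, rfl⟩
      · exact hE'.elim
      -- The facet `L[j]` above `A` misses `x`, so `A` lies in `L[k] \ {x}`; that set is in the
      -- intersection too, and maximality forces equality.
      have hle : A ⊆ (L.get k).erase x := fun a ha =>
        Finset.mem_erase.2 ⟨fun hax => hxE (hax ▸ hAE ha), hA ha⟩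
      have hge : (L.get k).erase x ⊆ A := hmax
        ⟨Finset.erase_subset x (L.get k),
          L.get ⟨i, hi.trans k.2⟩, ⟨⟨i, hi.trans k.2⟩, hi, rfl⟩, hsub⟩ hle
      have hAeq : A = (L.get k).erase x := hle.antisymm hge
      have hcard : ((L.get k).erase x).card + 1 = (L.get k).card :=
        Finset.card_erase_add_one hx
      rw [hAeq, faceDim, faceDim, ← hcard]
      push_cast
      ring

theorem exists_isFacet_of_mem [Finite V] {Δ : LowerSet (Finset V)} {A : Finset V} (hA : A ∈ Δ) :
    ∃ F, IsFacet Δ F ∧ A ⊆ F := by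
  obtain ⟨F, hF, h⟩ := (Set.toFinite {A | A ∈ Δ}).exists_le_maximal hA
  exact ⟨F, h, hF⟩

/-- A vertex `v` is simplicial in the link of `W` if, for each face `A` of the star of `W` to
which `v` cannot be added, the minimal subset of `A \ W` obstructing this is unique, that is,
it consists of those `y` whose removal from `A` allows `v` to be added. -/
def IsSimplicialVertex [DecidableEq V] (Δ : LowerSet (Finset V)) (W : Finset V) (v : V) : Prop :=
  v ∉ W ∧ insert v W ∈ Δ ∧ ∀ A ∈ Δ, W ⊆ A → v ∉ A → insert v A ∉ Δ →
    ∀ T : Finset V, W ⊆ T → (∀ y ∈ A, insert v (A.erase y) ∈ Δ → y ∈ T) → insert v T ∉ Δ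

open Classical in
theorem exists_isShellingFrom_of_isSimplicialVertex [Finite V] {Δ : LowerSet (Finset V)}
    (h : ∀ W ∈ Δ, ¬ IsFacet Δ W → ∃ v, IsSimplicialVertex Δ W v) (W : Finset V) (hW : W ∈ Δ) :
    ∃ L : List (Finset V), L.Nodup ∧ (∀ F, F ∈ L ↔ IsFacet Δ F ∧ W ⊆ F) ∧
      IsShellingFrom ∅ L := by
  have := Fintype.ofFinite V
  by_cases hfac : IsFacet Δ W
  · refine ⟨[W], by simp, fun F => ?_, ⟨by simp, trivial⟩⟩
    rw [List.mem_singleton]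
    constructor
    · rintro rfl
      exact ⟨hfac, subset_rfl⟩
    · rintro ⟨hF, hWF⟩
      exact Finset.Subset.antisymm (hfac.2 hF.1 hWF) hWF
  obtain ⟨v, hvW, hvΔ, hv⟩ := h W hW hfac
  have ih : ∀ T : Finset V, W ⊂ T → T ∈ Δ → ∃ L : List (Finset V), L.Nodup ∧
      (∀ F, F ∈ L ↔ IsFacet Δ F ∧ T ⊆ F) ∧ IsShellingFrom ∅ L := fun T hT hTΔ =>
    have : Nat.card V - T.card < Nat.card V - W.card := by
      have h₁ := Finset.card_lt_card hT
      have h₂ := T.card_le_univ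
      rw [Nat.card_eq_fintype_card]
      lia
    exists_isShellingFrom_of_isSimplicialVertex h T hTΔ
  obtain ⟨L₀, hL₀, hmem₀, hsh₀⟩ := ih (insert v W) (Finset.ssubset_insert hvW) hvΔ
  -- For `A ∈ s`, `κ A` is the least set between `W` and `A` to which `v` cannot be added: `hκ`
  -- gives the obstruction, `hκle` the minimality.
  let κ : Finset V → Finset V := fun A => W ∪ A.filter fun y => insert v (A.erase y) ∈ Δ
  let s : Finset (Finset V) := Finset.univ.filter fun F => IsFacet Δ F ∧ W ⊆ F ∧ v ∉ F
  have hκsub : ∀ A, W ⊆ A → κ A ⊆ A := fun A hA =>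
    Finset.union_subset hA (Finset.filter_subset _ _)
  have hs : ∀ F ∈ s, IsFacet Δ F ∧ W ⊆ F ∧ v ∉ F := fun F hF => (Finset.mem_filter.1 hF).2
  have hκ : ∀ F ∈ s, insert v (κ F) ∉ Δ := by
    intro F hF
    obtain ⟨hF, hWF, hvF⟩ := hs F hF
    refine hv F hF.1 hWF hvF (fun hins => hvF ?_) (κ F) Finset.subset_union_left ?_
    · exact hF.2 hins (Finset.subset_insert v F) (Finset.mem_insert_self v F)
    · intro y hy hyΔ
      exact Finset.mem_union_right _ (Finset.mem_filter.2 ⟨hy, hyΔ⟩)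
  have hκle : ∀ A T, W ⊆ T → T ⊆ A → insert v T ∉ Δ → κ A ⊆ T := by
    intro A T hWT hTA hT y hy
    rcases Finset.mem_union.1 hy with hy | hy
    · exact hWT hy
    · by_contra hyT
      refine hT (Δ.lower (Finset.insert_subset_insert v ?_) (Finset.mem_filter.1 hy).2)
      exact fun a ha => Finset.mem_erase.2 ⟨fun hay => hyT (hay ▸ ha), hTA ha⟩
  have hmem_s : ∀ T, insert v T ∉ Δ → W ⊆ T → ∀ F, IsFacet Δ F → T ⊆ F → F ∈ s := by
    intro T hT hWT F hF hTF
    exact Finset.mem_filter.2 ⟨Finset.mem_univ _, hF, hWT.trans hTF, fun hvF =>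
      hT (Δ.lower (Finset.insert_subset hvF hTF) hF.1)⟩
  have hκeq : ∀ F₀ ∈ s, ∀ F, IsFacet Δ F → κ F₀ ⊆ F → κ F = κ F₀ := by
    intro F₀ hF₀ F hF hsub
    have hWκ : ∀ A, W ⊆ κ A := fun A => Finset.subset_union_left
    have h1 : κ F ⊆ κ F₀ := hκle F _ (hWκ _) hsub (hκ F₀ hF₀)
    refine h1.antisymm (hκle F₀ _ (hWκ _) (h1.trans (hκsub _ (hs F₀ hF₀).2.1)) (hκ F ?_))
    exact hmem_s _ (hκ F₀ hF₀) (hWκ _) F hF hsub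
  have ih' : ∀ T : Finset V, ∃ L : List (Finset V), T ∈ s.image κ → L.Nodup ∧
      (∀ F, F ∈ L ↔ IsFacet Δ F ∧ T ⊆ F) ∧ IsShellingFrom ∅ L := by
    intro T
    by_cases hT : T ∈ s.image κ
    · obtain ⟨F, hF, rfl⟩ := Finset.mem_image.1 hT
      -- The inclusion is strict because `v` can be added to `W` but not to `κ F`.
      obtain ⟨L, hL⟩ := ih (κ F) ⟨Finset.subset_union_left, fun hsub =>
        hκ F hF (Δ.lower (Finset.insert_subset_insert v hsub) hvΔ)⟩
        (Δ.lower (hκsub F (hs F hF).2.1) (hs F hF).1.1)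
      exact ⟨L, fun _ => hL⟩
    · exact ⟨[], fun h => (hT h).elim⟩
  choose L hL using ih'
  have hgroup : ∀ T ∈ s.image κ, ∀ F ∈ L T, F ∈ s ∧ κ F = T := by
    intro T hT F hF
    obtain ⟨hFf, hTF⟩ := ((hL T hT).2.1 F).1 hF
    obtain ⟨F₀, hF₀, rfl⟩ := Finset.mem_image.1 hT
    exact ⟨hmem_s _ (hκ F₀ hF₀) Finset.subset_union_left F hFf hTF, hκeq F₀ hF₀ F hFf hTF⟩
  refine ⟨L₀ ++ (s.image κ).toList.flatMap L, ?_, ?_, ?_⟩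
  · refine List.nodup_append.2 ⟨hL₀, ?_, ?_⟩
    · refine List.nodup_flatMap.2 ⟨fun T hT => (hL T (Finset.mem_toList.1 hT)).1, ?_⟩
      refine (Finset.nodup_toList _).pairwise_of_forall_ne ?_
      intro T hT T' hT' hne F hF hF'
      exact hne ((hgroup T (Finset.mem_toList.1 hT) F hF).2.symm.trans
        (hgroup T' (Finset.mem_toList.1 hT') F hF').2)
    · rintro F hF F' hF' rfl
      obtain ⟨T, hT, hFT⟩ := List.mem_flatMap.1 hF'
      exact (hs F (hgroup T (Finset.mem_toList.1 hT) F hFT).1).2.2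
        (((hmem₀ F).1 hF).2 (Finset.mem_insert_self v W))
  · intro F
    rw [List.mem_append, List.mem_flatMap, hmem₀]
    constructor
    · rintro (⟨hF, hsub⟩ | ⟨T, hT, hF⟩)
      · exact ⟨hF, (Finset.subset_insert v W).trans hsub⟩
      · have := hs F (hgroup T (Finset.mem_toList.1 hT) F hF).1
        exact ⟨this.1, this.2.1⟩
    · rintro ⟨hF, hWF⟩
      by_cases hvF : v ∈ F
      · exact Or.inl ⟨hF, Finset.insert_subset hvF hWF⟩
      · have hFs : F ∈ s := Finset.mem_filter.2 ⟨Finset.mem_univ _, hF, hWF, hvF⟩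
        have hT : κ F ∈ s.image κ := Finset.mem_image_of_mem κ hFs
        exact Or.inr ⟨κ F, Finset.mem_toList.2 hT,
          ((hL _ hT).2.1 F).2 ⟨hF, hκsub F hWF⟩⟩
  · refine hsh₀.append (IsShellingFrom.flatMap (Finset.nodup_toList _)
      (fun T hT => (hL T (Finset.mem_toList.1 hT)).2.2) ?_)
    intro T hT F hF E hE
    rw [Finset.mem_toList] at hT
    obtain ⟨hFs, rfl⟩ := hgroup T hT F hF
    have hWE : W ⊆ E ∧ ¬ κ F ⊆ E := by
      rcases hE with (hE | hE) | ⟨T', hT', hne, hE⟩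
      · exact hE.elim
      · obtain ⟨hE, hsub⟩ := (hmem₀ E).1 hE
        exact ⟨(Finset.subset_insert v W).trans hsub, fun hκE => hκ F hFs
          (Δ.lower (Finset.insert_subset (hsub (Finset.mem_insert_self v W)) hκE) hE.1)⟩
      · obtain ⟨hEs, rfl⟩ := hgroup T' (Finset.mem_toList.1 hT') E hE
        exact ⟨(hs E hEs).2.1, fun hκE => hne (hκeq F hFs E (hs E hEs).1 hκE)⟩
    obtain ⟨x, hx, hxE⟩ := Finset.not_subset.1 hWE.2
    have hxF : x ∈ F := hκsub F (hs F hFs).2.1 hx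
    rcases Finset.mem_union.1 hx with hxW | hx'
    · exact (hxE (hWE.1 hxW)).elim
    -- Replacing `x` by `v` in `F` gives a face that still contains `W`, so any facet above it is
    -- listed in `L₀`.
    obtain ⟨E', hE', hsub⟩ := exists_isFacet_of_mem (Finset.mem_filter.1 hx').2
    refine ⟨E', Or.inr ((hmem₀ E').2 ⟨hE', fun a ha => hsub ?_⟩), x, hxF, hxE,
      (Finset.subset_insert v _).trans hsub⟩
    rcases Finset.mem_insert.1 ha with rfl | ha
    · exact Finset.mem_insert_self _ _
    · exact Finset.mem_insert_of_mem (Finset.mem_erase.2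
        ⟨fun hax => hxE (hax ▸ hWE.1 ha), (hs F hFs).2.1 ha⟩)
termination_by Nat.card V - W.card

open Classical in
theorem isShellable_of_isSimplicialVertex [Finite V] {Δ : LowerSet (Finset V)}
    (hne : ∅ ∈ Δ) (h : ∀ W ∈ Δ, ¬ IsFacet Δ W → ∃ v, IsSimplicialVertex Δ W v) :
    IsShellable Δ := by
  obtain ⟨L, hL, hmem, hsh⟩ := exists_isShellingFrom_of_isSimplicialVertex h ∅ hne
  exact isShellable_of_isShellingFrom hL (fun F => by simp [hmem F]) hsh

end Shelling

namespace SimpleGraph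

variable {V : Type*} {G : SimpleGraph V}

/-! ### Reachability inside a set of vertices -/

/-- The set of vertices that can be reached from `v` by a walk inside `S`. -/
def reachIn (G : SimpleGraph V) (S : Set V) (v : V) : Set V :=
  {u | ∃ p : G.Walk v u, ∀ x ∈ p.support, x ∈ S}

section reachIn

variable {S T : Set V} {u v w : V}

theorem self_mem_reachIn (hv : v ∈ S) : v ∈ G.reachIn S v :=
  ⟨Walk.nil, by simpa using hv⟩

theorem reachIn_subset : G.reachIn S v ⊆ S :=
  fun _ ⟨p, hp⟩ => hp _ p.end_mem_support

theorem reachIn_symm (h : u ∈ G.reachIn S v) : v ∈ G.reachIn S u := by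
  obtain ⟨p, hp⟩ := h
  exact ⟨p.reverse, by simpa using hp⟩

theorem reachIn_trans (h : u ∈ G.reachIn S v) (h' : w ∈ G.reachIn S u) :
    w ∈ G.reachIn S v := by
  obtain ⟨p, hp⟩ := h
  obtain ⟨q, hq⟩ := h'
  refine ⟨p.append q, fun x hx => ?_⟩
  rcases (Walk.mem_support_append_iff p q).1 hx with hx | hx
  exacts [hp x hx, hq x hx]

theorem reachIn_of_adj (hv : v ∈ S) (hu : u ∈ S) (h : G.Adj v u) : u ∈ G.reachIn S v :=
  ⟨Walk.cons h Walk.nil, by simp [hv, hu]⟩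

theorem reachIn_adj (h : u ∈ G.reachIn S v) (huw : G.Adj u w) (hw : w ∈ S) :
    w ∈ G.reachIn S v :=
  reachIn_trans h (reachIn_of_adj (reachIn_subset h) hw huw)

theorem reachable_of_mem_reachIn (h : u ∈ G.reachIn S v) : G.Reachable v u :=
  ⟨h.choose⟩

theorem reachIn_induction {motive : V → Prop} (h : u ∈ G.reachIn S v) (base : motive v)
    (step : ∀ x ∈ G.reachIn S v, motive x → ∀ z ∈ S, G.Adj x z → motive z) : motive u := by
  obtain ⟨p, hp⟩ := h
  suffices ∀ (x y : V) (q : G.Walk x y), x ∈ G.reachIn S v → motive x →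
      (∀ z ∈ q.support, z ∈ S) → motive y from
    this v u p (self_mem_reachIn (hp v p.start_mem_support)) base hp
  intro x y q
  induction q with
  | nil => exact fun _ h _ => h
  | cons hadj q ih =>
    intro hx hm hS
    have hz := hS _ (List.mem_cons_of_mem _ q.start_mem_support)
    exact ih (reachIn_adj hx hadj hz) (step _ hx hm _ hz hadj)
      fun z hz => hS z (List.mem_cons_of_mem _ hz)

/-- Every walk from `v` inside `S` visits only vertices of `G.reachIn S v`, so `T` need not contain
the rest of `S`. -/
theorem reachIn_subset_reachIn (h : G.reachIn S v ⊆ T) : G.reachIn S v ⊆ G.reachIn T v := by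
  intro u hu
  have hv : v ∈ S := hu.choose_spec v (Walk.start_mem_support _)
  exact reachIn_induction hu (self_mem_reachIn (h (self_mem_reachIn hv)))
    fun x hx hm z hz hxz => reachIn_adj hm hxz (h (reachIn_adj hx hxz hz))

theorem reachable_induce_iff {x y : S} :
    (G.induce S).Reachable x y ↔ (y : V) ∈ G.reachIn S x := by
  constructor
  · rintro ⟨p⟩
    induction p with
    | nil => exact self_mem_reachIn (Subtype.prop _)
    | cons h _ ih =>
      exact reachIn_trans (reachIn_of_adj (Subtype.prop _) (Subtype.prop _) h) ih
  · rintro ⟨p, hp⟩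
    exact ⟨p.induce S hp⟩

theorem isRIndep_iff [Finite V] {r : ℕ} {A : Finset V} :
    G.IsRIndep r A ↔ ∀ v ∈ A, (G.reachIn A v).ncard ≤ r := by
  have key : ∀ v : (A : Set V),
      (((G.induce (A : Set V)).connectedComponentMk v).supp.encard ≤ r ↔
        (G.reachIn A v).ncard ≤ r) := by
    intro v
    have himage : Subtype.val '' ((G.induce (A : Set V)).connectedComponentMk v).supp =
        G.reachIn A v := by
      ext u
      constructor
      · rintro ⟨u, hu, rfl⟩
        rw [ConnectedComponent.mem_supp_iff, ConnectedComponent.eq] at hu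
        exact reachIn_symm (reachable_induce_iff.1 hu)
      · intro hu
        refine ⟨⟨u, reachIn_subset hu⟩, ?_, rfl⟩
        rw [ConnectedComponent.mem_supp_iff, ConnectedComponent.eq]
        exact reachable_induce_iff.2 (reachIn_symm hu)
    rw [← himage, Set.ncard_image_of_injective _ Subtype.val_injective,
      ← Set.Finite.cast_ncard_eq (Set.toFinite _)]
    exact Nat.cast_le
  constructor
  · exact fun h v hv => (key ⟨v, hv⟩).1 (h _)
  · intro h c
    induction c using ConnectedComponent.ind with
    | h v => exact (key v).2 (h v v.2)

/-- A component of the enlarged set that avoids `v` lies inside a component of `A`, so only the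
component of `v` can be too large. -/
theorem isRIndep_insert_iff [Finite V] [DecidableEq V] {r : ℕ} {A : Finset V}
    (hA : G.IsRIndep r A) :
    G.IsRIndep r (insert v A) ↔ (G.reachIn (insert v A : Finset V) v).ncard ≤ r := by
  rw [isRIndep_iff]
  refine ⟨fun h => h v (Finset.mem_insert_self v A), fun h u hu => ?_⟩
  by_cases huv : u ∈ G.reachIn (insert v A : Finset V) v
  · refine le_trans (Set.ncard_le_ncard (fun w hw => ?_) (Set.toFinite _)) h
    exact reachIn_trans huv hw
  · have huA : u ∈ A := by
      rcases Finset.mem_insert.1 hu with rfl | hu'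
      · exact (huv (self_mem_reachIn hu)).elim
      · exact hu'
    refine le_trans (Set.ncard_le_ncard (reachIn_subset_reachIn fun w hw => ?_)
      (Set.toFinite _)) (isRIndep_iff.1 hA u huA)
    rcases Finset.mem_insert.1 (reachIn_subset hw) with rfl | hw'
    · exact (huv (reachIn_symm hw)).elim
    · exact hw'

end reachIn

/-! ### Block graphs -/

theorem preconnected_induce_of_reachIn {S : Set V} (d : V) (h : S ⊆ G.reachIn S d) :
    ((⊤ : G.Subgraph).induce S).Preconnected := by
  rw [← preconnected_induce_iff]
  exact fun x y => reachable_induce_iff.2 (reachIn_trans (reachIn_symm (h x.2)) (h y.2))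

theorem IsBlockGraph.adj_of_mem_verts [Finite V] (hG : G.IsBlockGraph) {H : G.Subgraph}
    (hH : H.Connected) (hdel : ∀ v, (H.deleteVerts {v}).Preconnected) {a b : V}
    (ha : a ∈ H.verts) (hb : b ∈ H.verts) (hab : a ≠ b) : G.Adj a b := by
  obtain ⟨B, hHB, hB⟩ := (Set.toFinite {H : G.Subgraph |
    H.Connected ∧ ∀ v, (H.deleteVerts {v}).Preconnected}).exists_le_maximal ⟨hH, hdel⟩
  exact (hG B hB a (hHB.1 ha) b (hHB.1 hb) hab).adj_sub

/-- In a block graph, two neighbours of `c` in the same component of `G - c` are adjacent. -/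
theorem IsBlockGraph.adj_of_mem_reachIn [Finite V] (hG : G.IsBlockGraph) {a b c : V}
    (hca : G.Adj c a) (hcb : G.Adj c b) (hab : a ≠ b) (h : b ∈ G.reachIn {c}ᶜ a) :
    G.Adj a b := by
  classical
  obtain ⟨q, hq⟩ := h
  obtain ⟨p, hp, hcp⟩ : ∃ p : G.Walk a b, p.IsPath ∧ c ∉ p.support :=
    ⟨q.bypass, q.bypass_isPath, fun hc => hq c (q.support_bypass_subset_support hc) rfl⟩
  -- The path closes up through `c` to a cycle, so no vertex deletion disconnects the subgraph on
  -- `S`; it lies in a block, which is complete.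
  let S : Set V := insert c {x | x ∈ p.support}
  have hind : ∀ v, ((⊤ : G.Subgraph).induce S).deleteVerts {v} =
      (⊤ : G.Subgraph).induce (S \ {v}) := by
    intro v
    ext x y
    · simp
    · simp only [Subgraph.induce_adj, Subgraph.induce_verts,
        Subgraph.top_adj, Set.mem_sdiff, Set.mem_singleton_iff]
      tauto
  have hpart : ∀ T : Set V, c ∈ T → ∀ x (hx : x ∈ p.support),
      ((∀ y ∈ (p.takeUntil x hx).support, y ∈ T) ∨ ∀ y ∈ (p.dropUntil x hx).support, y ∈ T) →
      x ∈ G.reachIn T c := by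
    rintro T hc x hx (hT | hT)
    · exact ⟨Walk.cons hca (p.takeUntil x hx), by simpa [hc] using hT⟩
    · exact ⟨Walk.cons hcb (p.dropUntil x hx).reverse, by simpa [hc] using hT⟩
  have hpre : ((⊤ : G.Subgraph).induce S).Preconnected := by
    refine preconnected_induce_of_reachIn c ?_
    rintro x (rfl | hx)
    · exact self_mem_reachIn (Or.inl rfl)
    · exact hpart S (Or.inl rfl) x hx
        (Or.inl fun y hy => Or.inr (p.support_takeUntil_subset_support hx hy))
  have ha : a ∈ S := Or.inr p.start_mem_support
  refine hG.adj_of_mem_verts (H := (⊤ : G.Subgraph).induce S) ?_ ?_ ha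
    (Or.inr p.end_mem_support) hab
  · rw [Subgraph.connected_iff]
    exact ⟨hpre, a, ha⟩
  · intro v
    rw [hind]
    by_cases hv : v = c
    · subst hv
      refine preconnected_induce_of_reachIn a ?_
      rintro x ⟨rfl | hx, hxv⟩
      · exact (hxv rfl).elim
      · refine ⟨p.takeUntil x hx, fun y hy => ?_⟩
        have hy := p.support_takeUntil_subset_support hx hy
        exact ⟨Or.inr hy, fun hyv => hcp (hyv ▸ hy)⟩
    · refine preconnected_induce_of_reachIn c ?_
      have hc : c ∈ S \ {v} := ⟨Or.inl rfl, fun h => hv h.symm⟩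
      rintro x ⟨rfl | hx, hxv⟩
      · exact self_mem_reachIn hc
      · refine hpart _ hc x hx ?_
        -- The path repeats no vertex and `x ≠ v`, so one of its two pieces at `x` avoids `v` and
        -- leads to `c` through `a` or `b`.
        by_cases hvt : v ∈ (p.takeUntil x hx).support
        · refine Or.inr fun y hy =>
            ⟨Or.inr (p.support_dropUntil_subset_support hx hy), fun hyv => ?_⟩
          obtain rfl : y = v := hyv
          have hnodup := hp.support_nodup
          rw [← p.take_spec hx, Walk.support_append] at hnodup
          rw [Walk.mem_support_iff] at hy
          rcases hy with hy | hy
          · exact hxv hy.symm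
          · exact (List.nodup_append.1 hnodup).2.2 y hvt y hy rfl
        · refine Or.inl fun y hy =>
            ⟨Or.inr (p.support_takeUntil_subset_support hx hy), fun hyv => ?_⟩
          obtain rfl : y = v := hyv
          exact hvt hy

/-! ### Distances in block graphs -/

theorem exists_adj_dist_of_ne {c u : V} (h : G.Reachable c u) (hne : u ≠ c) :
    ∃ a, G.Adj c a ∧ u ∈ G.reachIn {c}ᶜ a ∧ G.Reachable a u ∧ G.dist a u + 1 ≤ G.dist c u := by
  obtain ⟨p, hp, hlen⟩ := h.exists_path_of_dist
  cases p with
  | nil => exact (hne rfl).elim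
  | @cons _ a _ hadj q =>
    rw [Walk.cons_isPath_iff] at hp
    refine ⟨a, hadj, ⟨q, fun x hx hxc => hp.2 (hxc ▸ hx)⟩, ⟨q⟩, ?_⟩
    rw [← hlen, Walk.length_cons]
    exact Nat.succ_le_succ (dist_le q)

/-- In a block graph, an inner vertex of a shortest path separates the two ends. -/
theorem IsBlockGraph.notMem_reachIn_of_dist_add_dist [Finite V] (hG : G.IsBlockGraph)
    {u v c : V} (hu : G.Reachable c u) (hv : G.Reachable c v) (huc : u ≠ c) (hvc : v ≠ c)
    (h : G.dist c u + G.dist c v = G.dist u v) : v ∉ G.reachIn {c}ᶜ u := by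
  intro hmem
  obtain ⟨a, hca, hau, hra, hda⟩ := exists_adj_dist_of_ne hu huc
  obtain ⟨b, hcb, hbv, hrb, hdb⟩ := exists_adj_dist_of_ne hv hvc
  -- The first steps `a`, `b` from `c` towards `u`, `v` would share a component of `G - c`, hence be
  -- equal or adjacent, and the route through them would be shorter than `G.dist u v`.
  have hab : G.dist a b ≤ 1 := by
    by_cases hab : a = b
    · simp [hab]
    · exact (dist_eq_one_iff_adj.2 (hG.adj_of_mem_reachIn hca hcb hab
        (reachIn_trans hau (reachIn_trans hmem (reachIn_symm hbv))))).le
  have h1 : G.dist u v ≤ G.dist u a + G.dist a v := hra.symm.dist_triangle_left v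
  have h2 : G.dist a v ≤ G.dist a b + G.dist b v :=
    (hca.reachable.symm.trans hcb.reachable).dist_triangle_left v
  have h3 : G.dist u a = G.dist a u := dist_comm
  lia

/-- Since `c` separates `u` from `v`, shortest walks from `w` to `u` and to `v` cannot both avoid
`c`. -/
theorem IsBlockGraph.dist_add_dist_le_or [Finite V] (hG : G.IsBlockGraph)
    {u v c w : V} (hu : G.Reachable c u) (hv : G.Reachable c v) (hw : G.Reachable c w)
    (huc : u ≠ c) (hvc : v ≠ c) (h : G.dist c u + G.dist c v = G.dist u v) :
    G.dist c w + G.dist c u ≤ G.dist w u ∨ G.dist c w + G.dist c v ≤ G.dist w v := by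
  classical
  have key : ∀ (x : V) (p : G.Walk w x), p.length = G.dist w x → c ∈ p.support →
      G.dist c w + G.dist c x ≤ G.dist w x := by
    intro x p hp hc
    rw [← hp, ← congrArg Walk.length (p.take_spec hc), Walk.length_append,
      dist_comm (u := c) (v := w)]
    exact add_le_add (dist_le _) (dist_le _)
  obtain ⟨p, hp⟩ := (hw.symm.trans hu).exists_walk_length_eq_dist
  obtain ⟨q, hq⟩ := (hw.symm.trans hv).exists_walk_length_eq_dist
  by_cases hcp : c ∈ p.support
  · exact Or.inl (key u p hp hcp)
  by_cases hcq : c ∈ q.support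
  · exact Or.inr (key v q hq hcq)
  refine (hG.notMem_reachIn_of_dist_add_dist hu hv huc hvc h ?_).elim
  refine reachIn_trans (reachIn_symm (u := u) (v := w) ?_) (u := w) ?_
  · exact ⟨p, fun x hx hxc => hcp (hxc ▸ hx)⟩
  · exact ⟨q, fun x hx hxc => hcq (hxc ▸ hx)⟩

theorem exists_dist_eq_of_le {u v : V} (h : G.Reachable u v) {k : ℕ} (hk : k ≤ G.dist u v) :
    ∃ c, G.Reachable c u ∧ G.Reachable c v ∧ G.dist c u = k ∧
      G.dist c u + G.dist c v = G.dist u v := by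
  obtain ⟨p, hp⟩ := h.exists_walk_length_eq_dist
  have h1 : G.dist u (p.getVert k) ≤ k :=
    (dist_le (p.take k)).trans (by simp [Walk.take_length])
  have h2 : G.dist (p.getVert k) v ≤ G.dist u v - k :=
    (dist_le (p.drop k)).trans (by simp [Walk.drop_length, hp])
  have h3 : G.dist u v ≤ G.dist u (p.getVert k) + G.dist (p.getVert k) v :=
    Reachable.dist_triangle_left ⟨p.take k⟩ v
  have h4 : G.dist (p.getVert k) u = G.dist u (p.getVert k) := dist_comm
  exact ⟨p.getVert k, ⟨(p.take k).reverse⟩, ⟨p.drop k⟩, by lia, by lia⟩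

theorem IsBlockGraph.exists_center [Finite V] (hG : G.IsBlockGraph)
    (hdiam : ∀ u v : V, G.Reachable u v → G.dist u v ≤ 4) (x : V) :
    ∃ c, G.Reachable c x ∧ ∀ w, G.Reachable c w → G.dist c w ≤ 2 := by
  -- `D` is the diameter of the component and `c` lies at distances `k` and `D - k` from the ends of
  -- a longest geodesic. These are positive and at most 2, and one of them bounds `G.dist c w`.
  have key : ∀ D k, 0 < k → k < D → D ≤ k + 2 → k ≤ 2 →
      (∀ u v, G.Reachable x u → G.Reachable u v → G.dist u v ≤ D) →
      (∃ u v, G.Reachable x u ∧ G.Reachable u v ∧ G.dist u v = D) →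
      ∃ c, G.Reachable c x ∧ ∀ w, G.Reachable c w → G.dist c w ≤ 2 := by
    rintro D k hk hkD h1 h2 hle ⟨u, v, hxu, huv, hD⟩
    obtain ⟨c, hcu, hcv, hk', hsum⟩ := exists_dist_eq_of_le huv (hkD.le.trans hD.ge)
    refine ⟨c, hcu.trans hxu.symm, fun w hw => ?_⟩
    have huc : u ≠ c := by
      rintro rfl
      simp at hk'
      lia
    have hvc : v ≠ c := by
      rintro rfl
      simp at hsum
      lia
    have hxw := hxu.trans (hcu.symm.trans hw)
    have hwu := hle w u hxw (hw.symm.trans hcu)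
    have hwv := hle w v hxw (hw.symm.trans hcv)
    rcases hG.dist_add_dist_le_or hcu hcv hw huc hvc hsum with h | h <;> lia
  by_cases h4 : ∃ u v, G.Reachable x u ∧ G.Reachable u v ∧ G.dist u v = 4
  · exact key 4 2 (by lia) (by lia) (by lia) (by lia) (fun u v _ => hdiam u v) h4
  by_cases h3 : ∃ u v, G.Reachable x u ∧ G.Reachable u v ∧ G.dist u v = 3
  · refine key 3 1 (by lia) (by lia) (by lia) (by lia) (fun u v hu huv => ?_) h3
    have := hdiam u v huv
    have : G.dist u v ≠ 4 := fun h => h4 ⟨u, v, hu, huv, h⟩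
    lia
  · refine ⟨x, Reachable.rfl, fun w hw => ?_⟩
    have := hdiam x w hw
    have : G.dist x w ≠ 4 := fun h => h4 ⟨x, w, Reachable.rfl, hw, h⟩
    have : G.dist x w ≠ 3 := fun h => h3 ⟨x, w, Reachable.rfl, hw, h⟩
    lia

end SimpleGraph

namespace SimpleGraph

variable {V : Type*} {G : SimpleGraph V}

/-! ### Simplicial vertices of links in the `r`-independence complex -/

/-- Let `X` and `Y` be the components of `v` before and after deleting `y` from `A ∪ {v}`. The
neighbours of `v` in `A` outside `P` form a clique, so `X` without `v` and `P` lies in one component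
of `A`, and `|X| ≤ r + 1 + |P|`. Deleting `y` also cuts `Q` off from `v`, so `|Y| ≤ |X| - 1 - |Q| ≤
r`. -/
theorem isRIndep_insert_erase [Finite V] [DecidableEq V] {r : ℕ} {A P Q : Finset V} {v y : V}
    (hA : G.IsRIndep r A) (hyA : y ∈ A) (hv : v ∉ A)
    (hyv : y ∈ G.reachIn (insert v A : Finset V) v)
    (hclique : ∀ a ∈ A, ∀ b ∈ A, a ∉ P → b ∉ P → G.Adj v a → G.Adj v b → a ≠ b → G.Adj a b)
    (hP : ∀ z ∈ P, ∀ z' ∈ A, G.Adj z z' → z' ∈ P)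
    (hQA : Q ⊆ A) (hyQ : ∀ z ∈ Q, G.Adj y z)
    (hQ : ∀ z ∈ Q, ∀ z' ∈ insert v A, G.Adj z z' → z' ≠ y → z' ∈ Q)
    (hcard : P.card ≤ Q.card) : G.IsRIndep r (insert v (A.erase y)) := by
  have hyQ' : y ∉ Q := fun h => (hyQ y h).ne rfl
  have hvy : v ≠ y := fun h => hv (h ▸ hyA)
  rw [isRIndep_insert_iff (isRIndep_iff.2 fun u hu => ?_)]
  swap
  · exact isRIndep_iff.1 (hA.mono (Finset.erase_subset y A)) u hu
  set X := G.reachIn (insert v A : Finset V) v with hX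
  set Y := G.reachIn (insert v (A.erase y) : Finset V) v with hY
  have hvX : v ∈ X := self_mem_reachIn (Finset.mem_insert_self v A)
  have hYX : Y ⊆ X := reachIn_subset_reachIn fun u hu =>
    Finset.insert_subset_insert v (Finset.erase_subset y A) (reachIn_subset hu)
  have hQX : ∀ z ∈ Q, z ∈ X := fun z hz =>
    reachIn_adj hyv (hyQ z hz) (Finset.mem_insert_of_mem (hQA hz))
  have hYQ : ∀ u ∈ Y, u ∉ insert y Q := by
    intro u hu
    refine reachIn_induction (motive := fun u => u ∉ insert y Q) hu ?_ ?_
    · rw [Finset.mem_insert]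
      rintro (h | h)
      exacts [hvy h, hv (hQA h)]
    · intro x hx hxn z hz hxz
      rw [Finset.mem_insert, not_or] at hxn ⊢
      refine ⟨?_, fun hzQ => hxn.2 (hQ z hzQ x (reachIn_subset (hYX hx)) hxz.symm hxn.1)⟩
      rintro rfl
      rcases Finset.mem_insert.1 hz with h | h
      exacts [hvy h.symm, (Finset.mem_erase.1 h).1 rfl]
  have hXr : (X \ (insert v P : Finset V)).ncard ≤ r := by
    have hstep : ∀ u ∈ X, u = v ∨ u ∈ P ∨
        ∃ n ∈ A, n ∉ P ∧ G.Adj v n ∧ u ∈ G.reachIn A n := by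
      intro u hu
      refine reachIn_induction (motive := fun u => u = v ∨ u ∈ P ∨
        ∃ n ∈ A, n ∉ P ∧ G.Adj v n ∧ u ∈ G.reachIn A n) hu (Or.inl rfl) ?_
      intro x hx hm z hz hxz
      rcases Finset.mem_insert.1 hz with rfl | hzA
      · exact Or.inl rfl
      refine Or.inr ?_
      rcases hm with rfl | hxP | ⟨n, hn, hnP, hvn, hxn⟩
      · by_cases hzP : z ∈ P
        · exact Or.inl hzP
        · exact Or.inr ⟨z, hzA, hzP, hxz, self_mem_reachIn hzA⟩
      · exact Or.inl (hP x hxP z hzA hxz)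
      · exact Or.inr ⟨n, hn, hnP, hvn, reachIn_adj hxn hxz hzA⟩
    by_cases hex : ∃ n ∈ A, n ∉ P ∧ G.Adj v n
    · obtain ⟨n, hn, hnP, hvn⟩ := hex
      refine le_trans (Set.ncard_le_ncard ?_ (Set.toFinite _)) (isRIndep_iff.1 hA n hn)
      rintro u ⟨hu, hu'⟩
      rw [Finset.mem_coe, Finset.mem_insert, not_or] at hu'
      rcases hstep u hu with h | h | ⟨m, hm, hmP, hvm, hum⟩
      · exact (hu'.1 h).elim
      · exact (hu'.2 h).elim
      · by_cases hnm : n = m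
        · exact hnm ▸ hum
        · exact reachIn_trans (reachIn_of_adj hn hm
            (hclique n hn m hm hnP hmP hvn hvm hnm)) hum
    · have : X \ (insert v P : Finset V) = ∅ := by
        rw [Set.eq_empty_iff_forall_notMem]
        rintro u ⟨hu, hu'⟩
        rw [Finset.mem_coe, Finset.mem_insert, not_or] at hu'
        rcases hstep u hu with h | h | ⟨m, hm, hmP, hvm, -⟩
        · exact hu'.1 h
        · exact hu'.2 h
        · exact hex ⟨m, hm, hmP, hvm⟩
      rw [this, Set.ncard_empty]
      exact Nat.zero_le r
  have h1 : Y.ncard + (insert y Q).card ≤ X.ncard := by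
    rw [← Set.ncard_coe_finset, ← Set.ncard_union_eq _ (Set.toFinite _) (Set.toFinite _)]
    · refine Set.ncard_le_ncard (Set.union_subset hYX fun u hu => ?_) (Set.toFinite _)
      rcases Finset.mem_insert.1 hu with rfl | hu
      exacts [hyv, hQX u hu]
    · exact Set.disjoint_left.2 hYQ
  have h2 : X.ncard ≤ (X \ (insert v P : Finset V)).ncard + (insert v P).card := by
    rw [← Set.ncard_coe_finset]
    exact Set.ncard_le_ncard_sdiff_add_ncard _ _ (Set.toFinite _)
  have h3 := Finset.card_insert_le v P
  rw [Finset.card_insert_of_notMem hyQ'] at h1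
  lia

/-- If all vertices of the component of `v` in `A ∪ {v}` outside `W ∪ {c}` are needed to
obstruct adding `v` to `A`, for all faces `A` containing `W`, then `v` is simplicial. -/
theorem isSimplicialVertex_of_forall [Finite V] [DecidableEq V] {r : ℕ} {W : Finset V} {v : V}
    (c : V) (hvW : v ∉ W) (hvΔ : G.IsRIndep r (insert v W))
    (h : ∀ A, G.IsRIndep r A → W ⊆ A → v ∉ A →
      ∀ y ∈ A, y ∉ W → y ≠ c → y ∈ G.reachIn (insert v A : Finset V) v →
        G.IsRIndep r (insert v (A.erase y))) :
    IsSimplicialVertex (G.rIndComplex r) W v := by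
  refine ⟨hvW, hvΔ, fun A hA hWA hvA hins T hWT hT hTΔ => ?_⟩
  change G.IsRIndep r A at hA
  change ¬ G.IsRIndep r (insert v A) at hins
  change G.IsRIndep r (insert v T) at hTΔ
  -- The exceptional vertex is harmless: either its removal lets `v` in, and then `T` contains it if
  -- `A` does, or `A` without `c` still obstructs `v`.
  obtain ⟨B, hBA, hB, hcB⟩ : ∃ B ⊆ A, ¬ G.IsRIndep r (insert v B) ∧ (c ∈ B → c ∈ T) := by
    by_cases hc : G.IsRIndep r (insert v (A.erase c))
    · exact ⟨A, subset_rfl, hins, fun hcA => hT c hcA hc⟩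
    · exact ⟨A.erase c, Finset.erase_subset c A, hc, fun h => ((Finset.mem_erase.1 h).1 rfl).elim⟩
  rw [isRIndep_insert_iff (hA.mono hBA)] at hB
  refine hB (le_trans (Set.ncard_le_ncard (reachIn_subset_reachIn fun u hu => ?_)
    (Set.toFinite _)) (isRIndep_iff.1 hTΔ v (Finset.mem_insert_self v T)))
  rcases Finset.mem_insert.1 (reachIn_subset hu) with rfl | huB
  · exact Finset.mem_insert_self _ _
  refine Finset.mem_insert_of_mem ?_
  by_cases huW : u ∈ W
  · exact hWT huW
  by_cases huc : u = c
  · exact huc ▸ hcB (huc ▸ huB)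
  · refine hT u (hBA huB) (h A hA hWA hvA u (hBA huB) huW huc ?_)
    exact reachIn_subset_reachIn (fun w hw =>
      Finset.insert_subset_insert v hBA (reachIn_subset hw)) hu

/-! ### Components of radius at most two around `c` -/

section center

variable {c : V}

theorem eq_or_adj_or_of_dist_le_two {w : V} (h : G.Reachable c w) (hd : G.dist c w ≤ 2) :
    w = c ∨ G.Adj c w ∨ ∃ y, G.Adj c y ∧ G.Adj y w := by
  obtain ⟨p, hp⟩ := h.exists_walk_length_eq_dist
  rw [← hp] at hd
  match p, hd with
  | .nil, _ => exact Or.inl rfl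
  | .cons h .nil, _ => exact Or.inr (Or.inl h)
  | .cons h (.cons h' .nil), _ => exact Or.inr (Or.inr ⟨_, h, h'⟩)

theorem IsBlockGraph.adj_of_cycle [Finite V] (hG : G.IsBlockGraph) {a b d x : V}
    (hxa : G.Adj x a) (hxb : G.Adj x b) (hda : G.Adj d a) (hdb : G.Adj d b) (hab : a ≠ b)
    (hxd : x ≠ d) : G.Adj a b :=
  hG.adj_of_mem_reachIn hxa hxb hab <| reachIn_trans (u := d)
    (reachIn_of_adj hxa.ne.symm hxd.symm hda.symm) (reachIn_of_adj hxd.symm hxb.ne.symm hdb)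

/-- In a block graph of radius at most two around `c`, the vertices beyond a neighbour `y`
of `c` are adjacent only to `y` and to vertices beyond `y`. -/
theorem IsBlockGraph.eq_or_adj_of_adj [Finite V] (hG : G.IsBlockGraph)
    (hc : ∀ w, G.Reachable c w → w = c ∨ G.Adj c w ∨ ∃ y, G.Adj c y ∧ G.Adj y w)
    {y z z' : V} (hzc : z ≠ c) (hcz : ¬ G.Adj c z) (hcy : G.Adj c y) (hyz : G.Adj y z)
    (hzz' : G.Adj z z') : z' = y ∨ (z' ≠ c ∧ ¬ G.Adj c z') ∧ G.Adj y z' := by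
  by_cases hz'y : z' = y
  · exact Or.inl hz'y
  refine Or.inr ?_
  rcases hc z' (hcy.reachable.trans (hyz.reachable.trans hzz'.reachable)) with
    rfl | hcz' | ⟨y', hcy', hyz'⟩
  · exact (hcz hzz'.symm).elim
  -- The 4-cycle `c, y, z, z'` would force the excluded chord from `c` to `z`.
  · exact (hcz (hG.adj_of_cycle hcy.symm hyz hcz'.symm hzz'.symm hzc.symm (Ne.symm hz'y))).elim
  have hz'c : z' ≠ c := fun h => hcz (h ▸ hzz'.symm)
  by_cases hcz' : G.Adj c z'
  · exact (hcz (hG.adj_of_cycle hcy.symm hyz hcz'.symm hzz'.symm hzc.symm (Ne.symm hz'y))).elim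
  refine ⟨⟨hz'c, hcz'⟩, ?_⟩
  by_cases hyy' : y = y'
  · exact hyy' ▸ hyz'
  -- The edge from `z` to `z'` links `y` and `y'` away from `c`, so they are adjacent; the 4-cycle
  -- `y, z, z', y'` then has the chord from `y` to `z'`.
  have hadj : G.Adj y y' := by
    refine hG.adj_of_mem_reachIn hcy hcy' hyy' ?_
    refine reachIn_trans (u := z) (reachIn_of_adj hcy.ne.symm hzc hyz) ?_
    exact reachIn_trans (u := z') (reachIn_of_adj hzc hz'c hzz')
      (reachIn_of_adj hz'c hcy'.ne.symm hyz'.symm)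
  exact hG.adj_of_cycle hyz.symm hzz' hadj.symm hyz' (Ne.symm hz'y) fun h => hcz (h ▸ hcy')

theorem IsBlockGraph.exists_isSimplicialVertex [Finite V] [DecidableEq V] (hG : G.IsBlockGraph)
    (hc : ∀ w, G.Reachable c w → w = c ∨ G.Adj c w ∨ ∃ y, G.Adj c y ∧ G.Adj y w)
    {r : ℕ} {W : Finset V}
    (hW : ∃ x, G.Reachable c x ∧ x ∉ W ∧ G.IsRIndep r (insert x W)) :
    ∃ v, IsSimplicialVertex (G.rIndComplex r) W v := by
  classical
  have hins : ∀ {A : Finset V}, G.IsRIndep r A → W ⊆ A → ∀ y ∈ A, G.IsRIndep r (insert y W) :=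
    fun hA hWA y hy => hA.mono (Finset.insert_subset hy hWA)
  by_cases hfar : ∃ v, G.Reachable c v ∧ v ∉ W ∧ G.IsRIndep r (insert v W) ∧
      v ≠ c ∧ ¬ G.Adj c v
  · obtain ⟨v, hcv, hvW, hvΔ, hvc, hncv⟩ := hfar
    obtain ⟨y, hcy, hyv⟩ : ∃ y, G.Adj c y ∧ G.Adj y v := by
      rcases hc v hcv with h | h | h
      exacts [(hvc h).elim, (hncv h).elim, h]
    refine ⟨v, isSimplicialVertex_of_forall c hvW hvΔ fun A hA hWA hvA x hx _ _ hxv =>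
      isRIndep_insert_erase (P := ∅) (Q := ∅) hA hx hvA hxv ?_ (by simp) (by simp) (by simp)
        (by simp) le_rfl⟩
    intro a _ b _ _ _ hva hvb hab
    rcases hG.eq_or_adj_of_adj hc hvc hncv hcy hyv hva with rfl | ⟨-, hya⟩
    · rcases hG.eq_or_adj_of_adj hc hvc hncv hcy hyv hvb with rfl | ⟨-, hyb⟩
      exacts [(hab rfl).elim, hyb]
    · rcases hG.eq_or_adj_of_adj hc hvc hncv hcy hyv hvb with rfl | ⟨-, hyb⟩
      · exact hya.symm
      · exact hG.adj_of_cycle hva hvb hya hyb hab hyv.ne.symm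
  have := Fintype.ofFinite V
  -- Since no vertex at distance two can be added, every face containing `W` has its vertices beyond
  -- a neighbour `y` of `c` already in `W`. Hence `pend y` can be compared before `A` is chosen.
  let pend : V → Finset V := fun y => W.filter fun z => (z ≠ c ∧ ¬ G.Adj c z) ∧ G.Adj y z
  have hpend : ∀ {y z}, z ∈ pend y ↔ z ∈ W ∧ (z ≠ c ∧ ¬ G.Adj c z) ∧ G.Adj y z :=
    Finset.mem_filter
  have hpend_of : ∀ {A : Finset V}, G.IsRIndep r A → W ⊆ A → ∀ y z, G.Adj c y → G.Adj y z →
      z ∈ A → z ≠ c → ¬ G.Adj c z → z ∈ pend y := by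
    intro A hA hWA y z hcy hyz hz hzc hcz
    refine hpend.2 ⟨?_, ⟨hzc, hcz⟩, hyz⟩
    by_contra hzW
    exact hfar ⟨z, hcy.reachable.trans hyz.reachable, hzW, hins hA hWA z hz, hzc, hcz⟩
  let s : Finset V := Finset.univ.filter fun v =>
    v ∉ W ∧ G.IsRIndep r (insert v W) ∧ G.Adj c v
  rcases s.eq_empty_or_nonempty with hs | hs
  · obtain ⟨x, hcx, hxW, hxΔ⟩ := hW
    have honly : ∀ y, G.Reachable c y → y ∉ W → G.IsRIndep r (insert y W) → y = c := by
      intro y hy hyW hyΔ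
      by_contra hyc
      by_cases hcy : G.Adj c y
      · have : y ∈ s := Finset.mem_filter.2 ⟨Finset.mem_univ y, hyW, hyΔ, hcy⟩
        simp [hs] at this
      · exact hfar ⟨y, hy, hyW, hyΔ, hyc, hcy⟩
    -- Only `c` can be added within this component, so there is no `y` to check.
    refine ⟨x, isSimplicialVertex_of_forall c hxW hxΔ fun A hA hWA _ y hy hyW hyc hxy => ?_⟩
    exact (hyc (honly y (hcx.trans (reachable_of_mem_reachIn hxy)) hyW
      (hins hA hWA y hy))).elim
  · obtain ⟨v, hv, hmin⟩ := s.exists_min_image (fun v => (pend v).card) hs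
    obtain ⟨-, hvW, hvΔ, hcv⟩ := Finset.mem_filter.1 hv
    refine ⟨v, isSimplicialVertex_of_forall c hvW hvΔ fun A hA hWA hvA y hy hyW hyc hvy => ?_⟩
    have hry : G.Reachable c y := hcv.reachable.trans (reachable_of_mem_reachIn hvy)
    have hyΔ := hins hA hWA y hy
    have hcy : G.Adj c y := by
      by_contra hcy
      exact hfar ⟨y, hry, hyW, hyΔ, hyc, hcy⟩
    -- Here `y` also belongs to `s`, so by the choice of `v` at least as many vertices hang beyond
    -- `y` as beyond `v`. The other neighbours of `v` in `A` are `c` or neighbours of `c`, hence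
    -- form a clique.
    refine isRIndep_insert_erase (P := pend v) (Q := pend y) hA hy hvA hvy ?_ ?_
      ((Finset.filter_subset _ _).trans hWA) (fun z hz => (hpend.1 hz).2.2) ?_
      (hmin y (Finset.mem_filter.2 ⟨Finset.mem_univ y, hyW, hyΔ, hcy⟩))
    · have hnear : ∀ a ∈ A, a ∉ pend v → G.Adj v a → a ≠ c → G.Adj c a := by
        intro a ha hav hva hac
        by_contra hca
        exact hav (hpend_of hA hWA v a hcv hva ha hac hca)
      intro a ha b hb hav hbv hva hvb hab
      by_cases hac : a = c
      · subst hac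
        exact hnear b hb hbv hvb hab.symm
      by_cases hbc : b = c
      · subst hbc
        exact (hnear a ha hav hva hab).symm
      exact hG.adj_of_cycle hva hvb (hnear a ha hav hva hac) (hnear b hb hbv hvb hbc) hab
        hcv.ne.symm
    · intro z hz z' hz' hzz'
      obtain ⟨-, ⟨hzc, hcz⟩, hvz⟩ := hpend.1 hz
      rcases hG.eq_or_adj_of_adj hc hzc hcz hcv hvz hzz' with rfl | ⟨⟨h1, h2⟩, h3⟩
      · exact (hvA hz').elim
      · exact hpend_of hA hWA v z' hcv h3 hz' h1 h2
    · intro z hz z' hz' hzz' hz'y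
      obtain ⟨-, ⟨hzc, hcz⟩, hyz⟩ := hpend.1 hz
      rcases hG.eq_or_adj_of_adj hc hzc hcz hcy hyz hzz' with h | ⟨⟨h1, h2⟩, h3⟩
      · exact (hz'y h).elim
      · rcases Finset.mem_insert.1 hz' with rfl | hz'
        · exact (h2 hcv).elim
        · exact hpend_of hA hWA y z' hcy h3 hz' h1 h2

end center

end SimpleGraph

/-- A finite block graph all of whose distances (between vertices of the same connected component)
are at most `4` has a shellable `r`-independence complex for every `r ≥ 2`. -/
theorem theorem4p8 {V : Type*} [Finite V] (G : SimpleGraph V) (hG : G.IsBlockGraph)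
    (hdiam : ∀ u v : V, G.Reachable u v → G.dist u v ≤ 4) (r : ℕ) (hr : 2 ≤ r) :
    IsShellable (G.rIndComplex r) := by
  classical
  refine isShellable_of_isSimplicialVertex (SimpleGraph.isRIndep_iff.2 (by simp)) ?_
  intro W hW hfac
  obtain ⟨F, hF, hWF⟩ := exists_isFacet_of_mem hW
  obtain ⟨x, hxF, hxW⟩ := Finset.not_subset.1 fun hFW : F ⊆ W =>
    hfac (hWF.antisymm hFW ▸ hF)
  obtain ⟨c, hcx, hc⟩ := hG.exists_center hdiam x
  exact hG.exists_isSimplicialVertex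
    (fun w hw => SimpleGraph.eq_or_adj_or_of_dist_le_two hw (hc w hw))
    ⟨x, hcx, hxW, hF.1.mono (Finset.insert_subset hxF hWF)⟩
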